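/- Let $p,q\ge 0$ be integers and let $\mathbf b$ be a non-degenerate symmetric bilinear form of signature $(p,q+1)$ on $\mathbb R^{p,q+1}=\mathbb R^{p+q+1}$. The pseudo-hyperbolic space is $\mathbb H^{p,q}=\{[x]\in\mathbb P(\mathbb R^{p,q+1}) : \mathbf b(x,x)<0\}$, with the pseudo-Riemannian metric inherited from its double cover $\{x : \mathbf b(x,x)=-1\}$, which carries the metric induced by $\mathbf b$; $\mathrm{Vol}$ denotes the corresponding volume measure. Let $\Lambda\subset\mathbb P(\mathbb R^{p,q+1})$ be finite. A positive lift of $\Lambda$ is a choice of a non-zero vector $s(\xi)\in\xi$ for every line $\xi\in\Lambda$ such that $\mathbf b(s(\xi),s(\eta))\le 0$ for all $\xi,\eta\in\Lambda$ and $0$ does not belong to the convex hull of $s(\Lambda)$; one then writes $\mathrm{Conv}(s)$ for the interior in $\mathbb P(\mathbb R^{p,q+1})$ of the projectivization of the convex hull of $s(\Lambda)$. The set $\Lambda$ is a simplex of $\mathbb H^{p,q}$ if it has exactly $p+q+1$ points, these lines span $\mathbb R^{p,q+1}$, and $\Lambda$ admits a positive lift $s$ for which no point of $\Lambda$ lies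 in the projectivization of the convex hull of the lifts of the other points. The volume of the simplex is $\mathrm{Vol}(\mathrm{Conv}(s))$, for any positive lift $s$. The graph $\mathcal G(\Lambda)$ has vertex set $\Lambda$, and its edges are the pairs $\{\xi,\eta\}$ of possibly equal vertices (loops are allowed) such that the lines $\xi$ and $\eta$ are not $\mathbf b$-orthogonal. A set $I$ of vertices is stable if there is no edge between vertices of $I$ (in particular no loop at a vertex of $I$), and $\partial I$ is the set of vertices that are not in $I$ but adjacent to a vertex of $I$. **Theorem.** Let $\Lambda$ be a simplex of $\mathbb H^{p,q}$ and let $s$ be any positive lift of $\Lambda$. Then $\mathrm{Vol}(\mathrm{Conv}(s))=\infty$ (that is, $\Lambda$ has infinite volume) if and only if $\mathcal G(\Lambda)$ contains a non-empty stable set of vertices $I$ with $|I|\ge|\partial I|$. -/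

import Mathlib

open scoped LinearAlgebra.Projectivization ENNReal

noncomputable section

namespace PseudoHyperbolic

/-- The vector space underlying `ℝ^{p,q+1}`. -/
abbrev Space (p q : ℕ) : Type := Fin (p + q + 1) → ℝ

/-- The symmetric bilinear form of signature `(p, q+1)` on `ℝ^{p,q+1}`:
`b(x,y) = x₀y₀ + ⋯ + x_{p-1}y_{p-1} - x_p y_p - ⋯ - x_{p+q} y_{p+q}`. -/
def form (p q : ℕ) : LinearMap.BilinForm ℝ (Space p q) :=
  Matrix.toBilin' (Matrix.diagonal fun i : Fin (p + q + 1) => if (i : ℕ) < p then (1 : ℝ) else -1)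

theorem form_apply (p q : ℕ) (x y : Space p q) :
    form p q x y = ∑ i : Fin (p + q + 1), (if (i : ℕ) < p then (1 : ℝ) else -1) * x i * y i := by
  rw [form, Matrix.toBilin'_apply', dotProduct]
  refine Finset.sum_congr rfl fun i _ => ?_
  rw [Matrix.mulVec_diagonal]
  ring

/-- The projective space `P(ℝ^{p,q+1})`, the set of lines of `ℝ^{p,q+1}`. -/
abbrev Proj (p q : ℕ) : Type := ℙ ℝ (Space p q)

/-- The projective space carries the quotient topology of `ℝ^{p,q+1} ∖ {0}`. -/
instance (p q : ℕ) : TopologicalSpace (Proj p q) :=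
  TopologicalSpace.coinduced
    (fun v : {v : Space p q // v ≠ 0} => Projectivization.mk ℝ v.1 v.2) inferInstance

/-- The pseudo-hyperbolic space `H^{p,q}`: the lines on which `b` is negative definite. -/
def hyp (p q : ℕ) : Set (Proj p q) :=
  {ξ | ∀ v ∈ ξ.submodule, v ≠ 0 → form p q v v < 0}

/-- Orthogonality of two lines (possibly equal). -/
def Orthogonal {p q : ℕ} (ξ η : Proj p q) : Prop :=
  ∀ v ∈ ξ.submodule, ∀ w ∈ η.submodule, form p q v w = 0

/-! ### The pseudo-Riemannian volume of `H^{p,q}` -/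

/-- The vector with `k`-th coordinate `1` and other coordinates given by `u`. -/
def affinePoint {p q : ℕ} (k : Fin (p + q + 1)) (u : Fin (p + q) → ℝ) : Space p q :=
  k.insertNth (1 : ℝ) u

theorem affinePoint_ne_zero {p q : ℕ} (k : Fin (p + q + 1)) (u : Fin (p + q) → ℝ) :
    affinePoint k u ≠ 0 := by
  intro h
  have h1 := congrFun h k
  simp [affinePoint] at h1

/-- The (inverse of the) `k`-th affine chart of the projective space, onto `{x_k ≠ 0}`. -/
def affineChart {p q : ℕ} (k : Fin (p + q + 1)) (u : Fin (p + q) → ℝ) : Proj p q :=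
  Projectivization.mk ℝ (affinePoint k u) (affinePoint_ne_zero k u)

/-- The lift of the `k`-th affine chart to the double cover `{x | b(x,x) = -1}` of `H^{p,q}`
(meaningful where `affineChart k u` lies in `H^{p,q}`). -/
def quadricLift {p q : ℕ} (k : Fin (p + q + 1)) (u : Fin (p + q) → ℝ) : Space p q :=
  (Real.sqrt (-form p q (affinePoint k u) (affinePoint k u)))⁻¹ • affinePoint k u

/-- The metric of `H^{p,q}` in the `k`-th affine chart, `g_ij = b(∂_i ψ, ∂_j ψ)` with `ψ` the lift
of the chart to the quadric `{x | b(x,x) = -1}`, which has the metric induced by `b`. -/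
def metric {p q : ℕ} (k : Fin (p + q + 1)) (u : Fin (p + q) → ℝ) :
    Matrix (Fin (p + q)) (Fin (p + q)) ℝ :=
  Matrix.of fun i j =>
    form p q (fderiv ℝ (quadricLift k) u (Pi.single i 1))
      (fderiv ℝ (quadricLift k) u (Pi.single j 1))

/-- The volume of a Borel subset `A` of `H^{p,q}` for the pseudo-Riemannian metric. In each affine
chart the volume measure is `√|det g| du`; `H^{p,q}` is the disjoint union of the Borel pieces
`{[x] ∈ H^{p,q} | x_k ≠ 0, x_j = 0 for all j < k}`, each contained in the domain of the `k`-th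
affine chart, and the volume of `A` is the sum of the volumes of its intersections with them. -/
def vol {p q : ℕ} (A : Set (Proj p q)) : ℝ≥0∞ :=
  ∑ k : Fin (p + q + 1),
    ∫⁻ u in {u : Fin (p + q) → ℝ |
        affineChart k u ∈ A ∩ hyp p q ∧ ∀ j < k, affinePoint k u j = 0},
      ENNReal.ofReal (Real.sqrt |(metric k u).det|)

/-! ### Lifts, convex hulls, simplices -/

/-- A lift of a set of lines: the choice of a non-zero vector of each of them. -/
def IsLift {p q : ℕ} {Λ : Set (Proj p q)} (s : Λ → Space p q) : Prop :=
  ∀ ξ, s ξ ≠ 0 ∧ s ξ ∈ ξ.1.submodule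

/-- A lift is positive if the convex hull of its image does not contain `0` and
`b(s ξ, s η) ≤ 0` for all `ξ, η`, equal or not. -/
structure IsPositiveLift {p q : ℕ} {Λ : Set (Proj p q)} (s : Λ → Space p q) : Prop where
  isLift : IsLift s
  zero_notMem : (0 : Space p q) ∉ convexHull ℝ (Set.range s)
  form_nonpos : ∀ ξ η, form p q (s ξ) (s η) ≤ 0

/-- The image in the projective space of (the non-zero vectors of) a set of vectors. -/
def projectivize {p q : ℕ} (C : Set (Space p q)) : Set (Proj p q) :=
  {ξ | ∃ v ∈ C, v ≠ 0 ∧ v ∈ ξ.submodule}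

/-- The convex hull `Conv(s)` of `Λ` defined by a positive lift `s`: the interior, in the projective
space, of the projectivization of the convex hull of the image of `s`. -/
def hull {p q : ℕ} {Λ : Set (Proj p q)} (s : Λ → Space p q) : Set (Proj p q) :=
  interior (projectivize (convexHull ℝ (Set.range s)))

/-- A polytope: a finite set of lines with a positive lift in the convex hull of which each of them
is extremal, i.e. not a convex combination of the other ones. -/
def IsPolytope {p q : ℕ} (Λ : Set (Proj p q)) : Prop :=
  Λ.Finite ∧ ∃ s : Λ → Space p q, IsPositiveLift s ∧
    ∀ ξ : Λ, ξ.1 ∉ projectivize (convexHull ℝ (s '' {η | η ≠ ξ}))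

/-- A simplex: a polytope with `p + q + 1` vertices that span `ℝ^{p,q+1}`. -/
structure IsSimplex {p q : ℕ} (Λ : Set (Proj p q)) : Prop where
  isPolytope : IsPolytope Λ
  ncard_eq : Λ.ncard = p + q + 1
  span_eq_top : ⨆ ξ ∈ Λ, ξ.submodule = ⊤

/-! ### The non-orthogonality graph -/

/-- The graph with vertex set `Λ` whose edges are the pairs `{ξ, η}` of vertices, possibly equal
(loops), such that `ξ` and `η` are not orthogonal. -/
def nonOrthGraph {p q : ℕ} (Λ : Set (Proj p q)) : Graph (Proj p q) (Sym2 (Proj p q)) where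
  vertexSet := Λ
  IsLink e ξ η := e = s(ξ, η) ∧ ξ ∈ Λ ∧ η ∈ Λ ∧ ¬ Orthogonal ξ η
  isLink_symm := by
    intro e _
    refine ⟨fun ξ η h => ⟨h.1.trans Sym2.eq_swap, h.2.2.1, h.2.1, fun ho => h.2.2.2 ?_⟩⟩
    intro v hv w hw
    have h1 := ho w hw v hv
    rw [form_apply] at h1 ⊢
    rw [← h1]
    exact Finset.sum_congr rfl fun i _ => by ring
  eq_or_eq_of_isLink_of_isLink := by
    rintro e x y v w ⟨h1, -⟩ ⟨h2, -⟩
    rw [h1, Sym2.eq_iff] at h2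
    tauto

/-- A set of vertices is stable if there is no edge between its elements (in particular no loop). -/
def IsStable {α β : Type*} (G : Graph α β) (I : Set α) : Prop :=
  I ⊆ G.vertexSet ∧ ∀ x ∈ I, ∀ y ∈ I, ¬ G.Adj x y

/-- The boundary `∂I`: the vertices not in `I` that are adjacent to an element of `I`. -/
def boundary {α β : Type*} (G : Graph α β) (I : Set α) : Set α :=
  {y | y ∉ I ∧ ∃ x ∈ I, G.Adj x y}

end PseudoHyperbolic

end

open MeasureTheory
open scoped Pointwise

noncomputable section

namespace PseudoHyperbolic

theorem prod_zpow_eq_zpow_sum {ι K : Type*} [Field K] {a : K} (ha : a ≠ 0) (s : Finset ι)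
    (k : ι → ℤ) : ∏ i ∈ s, a ^ k i = a ^ ∑ i ∈ s, k i := by
  classical
  induction s using Finset.induction_on with
  | empty => simp
  | insert i s hi ih => rw [Finset.prod_insert hi, Finset.sum_insert hi, ih, zpow_add₀ ha]

/-- A non-negative quadratic form whose support is respected by a pair `I`, `J` of sets of indices
with `J` at most as large as `I` has a sublevel set of infinite volume in the open orthant. -/
theorem volume_quadratic_sublevel_eq_top {ι : Type*} [Fintype ι] [DecidableEq ι] (A : ι → ι → ℝ)
    (hA : ∀ i j, 0 ≤ A i j) (hsymm : ∀ i j, A i j = A j i) (I J : Finset ι) (hne : I.Nonempty)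
    (hdisj : Disjoint I J) (hIJ : ∀ i ∈ I, ∀ j, A i j ≠ 0 → j ∈ J) (hcard : J.card ≤ I.card) :
    volume {t : ι → ℝ | (∀ i, 0 < t i) ∧ ∑ i, ∑ j, A i j * t i * t j < 1} = ⊤ := by
  set S : ℝ := ∑ i, ∑ j, A i j with hS
  have hS0 : 0 ≤ S := Finset.sum_nonneg fun i _ => Finset.sum_nonneg fun j _ => hA i j
  set a : ℝ := 1 / (2 * (1 + S)) with ha
  have ha0 : 0 < a := by positivity
  have haS : 4 * a ^ 2 * S < 1 := by
    have h : 4 * a ^ 2 * S = S / (1 + S) ^ 2 := by rw [ha]; field_simp; ring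
    rw [h, div_lt_one (by positivity)]
    nlinarith
  let ε : ι → ℤ := fun i => (if i ∈ I then 1 else 0) - (if i ∈ J then 1 else 0)
  have hεI : ∀ i ∈ I, ε i = 1 := fun i hi => by
    simp [ε, hi, Finset.disjoint_left.1 hdisj hi]
  have hεJ : ∀ i ∈ J, ε i = -1 := fun i hi => by
    simp [ε, hi, Finset.disjoint_right.1 hdisj hi]
  have hεle : ∀ i, i ∉ I → ε i ≤ 0 := fun i hi => by
    simp only [ε, hi, if_false]; split_ifs <;> simp
  have hε : ∀ i j, A i j ≠ 0 → ε i + ε j ≤ 0 := by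
    intro i j h
    by_cases hi : i ∈ I
    · rw [hεI i hi, hεJ j (hIJ i hi j h)]; simp
    by_cases hj : j ∈ I
    · rw [hεI j hj, hεJ i (hIJ j hj i (hsymm i j ▸ h))]; simp
    · have := hεle i hi
      have := hεle j hj
      omega
  have hεsum : 0 ≤ ∑ i, ε i := by
    simp only [ε, Finset.sum_sub_distrib, Finset.sum_ite_mem, Finset.univ_inter, Finset.sum_const,
      nsmul_eq_mul, mul_one]
    omega
  let B : ℕ → Set (ι → ℝ) := fun k =>
    Set.univ.pi fun i => Set.Ioo (a * 2 ^ (ε i * k)) (2 * (a * 2 ^ (ε i * k)))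
  have hpos : ∀ z : ℤ, (0 : ℝ) < 2 ^ z := fun z => by positivity
  have hsub : (⋃ k, B k) ⊆
      {t : ι → ℝ | (∀ i, 0 < t i) ∧ ∑ i, ∑ j, A i j * t i * t j < 1} := by
    refine Set.iUnion_subset fun k t ht => ?_
    simp only [B, Set.mem_univ_pi, Set.mem_Ioo] at ht
    have ht0 : ∀ i, 0 < t i := fun i => (mul_pos ha0 (hpos _)).trans (ht i).1
    refine ⟨ht0, lt_of_le_of_lt ?_ haS⟩
    rw [hS, Finset.mul_sum]
    refine Finset.sum_le_sum fun i _ => ?_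
    rw [Finset.mul_sum]
    refine Finset.sum_le_sum fun j _ => ?_
    rcases eq_or_ne (A i j) 0 with h | h
    · simp [h]
    · rw [mul_assoc, mul_comm]
      refine mul_le_mul_of_nonneg_right ?_ (hA i j)
      calc t i * t j ≤ (2 * (a * 2 ^ (ε i * k))) * (2 * (a * 2 ^ (ε j * k))) :=
            mul_le_mul (ht i).2.le (ht j).2.le (ht0 j).le ((ht0 i).trans (ht i).2).le
        _ = 4 * a ^ 2 * 2 ^ ((ε i + ε j) * k) := by
            rw [add_mul, zpow_add₀ two_ne_zero]; ring
        _ ≤ 4 * a ^ 2 * 1 := by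
            refine mul_le_mul_of_nonneg_left ?_ (by positivity)
            exact zpow_le_one_of_nonpos₀ one_le_two
              (mul_nonpos_of_nonpos_of_nonneg (hε i j h) (by positivity))
        _ = _ := mul_one _
  have hvol : ∀ k, ENNReal.ofReal (a ^ Fintype.card ι) ≤ volume (B k) := by
    intro k
    simp only [B, Real.volume_pi_Ioo]
    rw [← ENNReal.ofReal_prod_of_nonneg fun i _ => by have := hpos (ε i * k); nlinarith]
    refine ENNReal.ofReal_le_ofReal ?_
    have h1 : ∀ i, 2 * (a * 2 ^ (ε i * k)) - a * 2 ^ (ε i * k) = a * (2 : ℝ) ^ (ε i * k) :=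
      fun i => by ring
    simp only [h1]
    rw [Finset.prod_mul_distrib, Finset.prod_const, Finset.card_univ]
    have h2 : ∏ i, (2 : ℝ) ^ (ε i * k) = 2 ^ ((∑ i, ε i) * k) := by
      rw [Finset.sum_mul]
      exact prod_zpow_eq_zpow_sum two_ne_zero _ _
    rw [h2]
    exact le_mul_of_one_le_right (by positivity)
      (one_le_zpow₀ one_le_two (mul_nonneg hεsum (by positivity)))
  have hdisjB : Pairwise (Function.onFun Disjoint B) := by
    refine (pairwise_disjoint_on B).2 ?_
    intro k l hkl
    obtain ⟨i, hi⟩ := hne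
    refine Set.disjoint_left.2 fun t hk hl => ?_
    have hk := (hk i trivial).2
    have hl := (hl i trivial).1
    simp only [hεI i hi, one_mul, zpow_natCast] at hk hl
    have : (2 : ℝ) ^ (k + 1) ≤ 2 ^ l := pow_le_pow_right₀ one_le_two hkl
    rw [pow_succ] at this
    nlinarith
  refine top_le_iff.1 (le_trans ?_ (measure_mono hsub))
  rw [measure_iUnion hdisjB fun k => MeasurableSet.univ_pi fun i => measurableSet_Ioo]
  refine le_trans ?_ (ENNReal.tsum_le_tsum hvol)
  rw [ENNReal.tsum_const_eq_top_of_ne_zero]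
  simpa using by positivity

/-- Layer counting: an integer vector that is non-positive on the edges of a relation without
non-empty stable sets `I` of size at least that of their boundary has a very negative sum. -/
theorem sum_le_neg_abs_of_forall_card_lt {ι : Type*} [Fintype ι] [DecidableEq ι]
    (r : ι → ι → Prop)
    (h : ∀ I J : Finset ι, I.Nonempty → (∀ i ∈ I, ∀ j ∈ I, ¬ r i j) →
      (∀ j, j ∉ I → (∃ i ∈ I, r i j) → j ∈ J) → I.card < J.card)
    (k : ι → ℤ) (hk : ∀ i j, r i j → k i + k j ≤ 0) (i : ι) :
    ∑ j, k j ≤ -|k i| := by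
  set N : ℕ := ∑ j, (k j).natAbs with hN
  have hNle : ∀ j, (k j).natAbs ≤ N := fun j =>
    Finset.single_le_sum (f := fun j => (k j).natAbs) (fun _ _ => Nat.zero_le _)
      (Finset.mem_univ j)
  have hcount : ∀ z : ℤ, z.natAbs ≤ N → z = ∑ c ∈ Finset.range N,
      ((if (c : ℤ) + 1 ≤ z then 1 else 0) - (if z ≤ -((c : ℤ) + 1) then 1 else 0) : ℤ) := by
    intro z hz
    rw [Finset.sum_sub_distrib, Finset.sum_boole, Finset.sum_boole]
    have h1 : (Finset.range N).filter (fun c : ℕ => (c : ℤ) + 1 ≤ z) = Finset.range z.toNat := by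
      ext c; simp only [Finset.mem_filter, Finset.mem_range]; omega
    have h2 : (Finset.range N).filter (fun c : ℕ => z ≤ -((c : ℤ) + 1)) =
        Finset.range (-z).toNat := by
      ext c; simp only [Finset.mem_filter, Finset.mem_range]; omega
    rw [h1, h2, Finset.card_range, Finset.card_range]
    omega
  have hlayer : ∀ c : ℕ, (∑ j, ((if (c : ℤ) + 1 ≤ k j then 1 else 0) -
      (if k j ≤ -((c : ℤ) + 1) then 1 else 0) : ℤ)) ≤ if c < (k i).natAbs then -1 else 0 := by
    intro c
    rw [Finset.sum_sub_distrib, Finset.sum_boole, Finset.sum_boole]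
    set I := Finset.univ.filter fun j => (c : ℤ) + 1 ≤ k j with hI
    set J := Finset.univ.filter fun j => k j ≤ -((c : ℤ) + 1) with hJ
    rcases I.eq_empty_or_nonempty with h0 | hne
    · rw [h0]
      split_ifs with hc
      · have hi : i ∈ J := by
          have : i ∉ I := by simp [h0]
          simp only [hI, hJ, Finset.mem_filter, Finset.mem_univ, true_and] at this ⊢
          omega
        have := Finset.card_pos.2 ⟨i, hi⟩
        simp only [Finset.card_empty]
        omega
      · simp
    · have := h I J hne
        (fun a ha b hb hab => by
          have := hk a b hab
          simp only [hI, Finset.mem_filter, Finset.mem_univ, true_and] at ha hb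
          omega)
        (fun b _ ⟨a, ha, hab⟩ => by
          have := hk a b hab
          simp only [hI, hJ, Finset.mem_filter, Finset.mem_univ, true_and] at ha ⊢
          omega)
      split_ifs <;> omega
  calc ∑ j, k j = ∑ j, ∑ c ∈ Finset.range N, ((if (c : ℤ) + 1 ≤ k j then 1 else 0) -
        (if k j ≤ -((c : ℤ) + 1) then 1 else 0) : ℤ) :=
        Finset.sum_congr rfl fun j _ => hcount _ (hNle j)
    _ ≤ ∑ c ∈ Finset.range N, if c < (k i).natAbs then -1 else 0 := by
        rw [Finset.sum_comm]
        exact Finset.sum_le_sum fun c _ => hlayer c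
    _ = -|k i| := by
        rw [← Finset.sum_filter]
        have : (Finset.range N).filter (fun c => c < (k i).natAbs) =
            Finset.range (k i).natAbs := by
          have := hNle i
          ext c; simp only [Finset.mem_filter, Finset.mem_range]; omega
        rw [this, Finset.sum_const, Finset.card_range]
        simp

/-- The part of the open orthant cut out by `t i * t j ≤ 1` along the edges of a relation has finite
volume if every non-empty stable set is smaller than its boundary. -/
theorem volume_forall_mul_le_one_lt_top {ι : Type*} [Fintype ι] [DecidableEq ι] [Nonempty ι]
    (r : ι → ι → Prop)
    (h : ∀ I J : Finset ι, I.Nonempty → (∀ i ∈ I, ∀ j ∈ I, ¬ r i j) →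
      (∀ j, j ∉ I → (∃ i ∈ I, r i j) → j ∈ J) → I.card < J.card) :
    volume {t : ι → ℝ | (∀ i, 0 < t i) ∧ ∀ i j, r i j → t i * t j ≤ 1} < ⊤ := by
  classical
  let B : (ι → ℤ) → Set (ι → ℝ) := fun k => Set.univ.pi fun i => Set.Ico (2 ^ k i) (2 ^ (k i + 1))
  have hvol : ∀ k, volume (B k) = ENNReal.ofReal (2 ^ ∑ i, k i) := by
    intro k
    simp only [B, Real.volume_pi_Ico]
    rw [← ENNReal.ofReal_prod_of_nonneg fun i _ => by
      rw [zpow_add_one₀ two_ne_zero]; have : (0 : ℝ) < 2 ^ k i := by positivity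
      linarith]
    congr 1
    rw [← prod_zpow_eq_zpow_sum two_ne_zero]
    refine Finset.prod_congr rfl fun i _ => ?_
    rw [zpow_add_one₀ two_ne_zero]; ring
  let F : ℕ → Finset (ι → ℤ) := fun m =>
    (Fintype.piFinset fun _ => Finset.Icc (-m : ℤ) m).filter fun k => ∑ i, k i ≤ -(m : ℤ)
  have hsub : {t : ι → ℝ | (∀ i, 0 < t i) ∧ ∀ i j, r i j → t i * t j ≤ 1} ⊆
      ⋃ m, ⋃ k ∈ F m, B k := by
    rintro t ⟨ht0, ht⟩
    choose k hk using fun i => exists_mem_Ico_zpow (ht0 i) one_lt_two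
    have hkr : ∀ i j, r i j → k i + k j ≤ 0 := by
      intro i j hij
      have h1 : (2 : ℝ) ^ (k i + k j) ≤ 2 ^ (0 : ℤ) := by
        rw [zpow_add₀ two_ne_zero, zpow_zero]
        exact (mul_le_mul (hk i).1 (hk j).1 (by positivity) (ht0 i).le).trans (ht i j hij)
      exact (zpow_le_zpow_iff_right₀ one_lt_two).1 h1
    obtain ⟨i₀, hi₀⟩ := Finite.exists_max fun i => |k i|
    refine Set.mem_iUnion.2 ⟨(k i₀).natAbs, Set.mem_iUnion₂.2 ⟨k, ?_, fun i _ => hk i⟩⟩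
    have h1 := sum_le_neg_abs_of_forall_card_lt r h k hkr i₀
    simp only [F, Finset.mem_filter, Fintype.mem_piFinset, Finset.mem_Icc, Int.natCast_natAbs]
    exact ⟨fun i => abs_le.1 (hi₀ i), h1⟩
  have hF : ∀ m, volume (⋃ k ∈ F m, B k) ≤
      ENNReal.ofReal ((2 * m + 1) ^ Fintype.card ι * (1 / 2) ^ m) := by
    intro m
    calc volume (⋃ k ∈ F m, B k) ≤ ∑ k ∈ F m, volume (B k) := measure_biUnion_finset_le _ _
      _ ≤ ∑ k ∈ F m, ENNReal.ofReal ((1 / 2) ^ m) := by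
          refine Finset.sum_le_sum fun k hk => ?_
          rw [hvol]
          refine ENNReal.ofReal_le_ofReal ?_
          have h1 := (Finset.mem_filter.1 hk).2
          calc (2 : ℝ) ^ ∑ i, k i ≤ 2 ^ (-(m : ℤ)) := zpow_le_zpow_right₀ one_le_two h1
            _ = (1 / 2) ^ m := by simp
      _ = (F m).card * ENNReal.ofReal ((1 / 2) ^ m) := by rw [Finset.sum_const, nsmul_eq_mul]
      _ ≤ ((2 * m + 1 : ℕ) ^ Fintype.card ι : ℕ) * ENNReal.ofReal ((1 / 2) ^ m) := by
          gcongr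
          refine (Finset.card_filter_le _ _).trans ?_
          rw [Fintype.card_piFinset, Finset.prod_const, Int.card_Icc, Finset.card_univ]
          gcongr
          omega
      _ = _ := by
          rw [ENNReal.ofReal_mul (by positivity), ← ENNReal.ofReal_natCast]
          push_cast
          rfl
  have hsum : Summable fun m : ℕ => ((2 * m + 1 : ℝ) ^ Fintype.card ι * (1 / 2) ^ m) := by
    have h1 : Summable fun m : ℕ => (m : ℝ) ^ Fintype.card ι * (1 / 2 : ℝ) ^ m :=
      summable_pow_mul_geometric_of_norm_lt_one _ (by norm_num)
    have h2 := ((summable_nat_add_iff 1).2 h1).mul_left (2 * 2 ^ Fintype.card ι)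
    refine Summable.of_nonneg_of_le (fun m => by positivity) (fun m => ?_) h2
    calc (2 * m + 1 : ℝ) ^ Fintype.card ι * (1 / 2) ^ m
        ≤ (2 * (m + 1)) ^ Fintype.card ι * (1 / 2) ^ m := by gcongr; linarith
      _ = _ := by push_cast; rw [mul_pow, pow_succ]; ring
  calc volume {t : ι → ℝ | (∀ i, 0 < t i) ∧ ∀ i j, r i j → t i * t j ≤ 1}
      ≤ ∑' m, volume (⋃ k ∈ F m, B k) := (measure_mono hsub).trans (measure_iUnion_le _)
    _ ≤ ∑' m : ℕ, ENNReal.ofReal ((2 * m + 1) ^ Fintype.card ι * (1 / 2) ^ m) :=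
        ENNReal.tsum_le_tsum hF
    _ < ⊤ := by
        rw [← ENNReal.ofReal_tsum_of_nonneg (fun m => by positivity) hsum]
        exact ENNReal.ofReal_lt_top

/-- If every non-empty stable set of indices is smaller than its boundary, the sublevel set of the
quadratic form in the orthant has finite volume. -/
theorem volume_quadratic_sublevel_lt_top {ι : Type*} [Fintype ι] [DecidableEq ι] [Nonempty ι]
    (A : ι → ι → ℝ) (hA : ∀ i j, 0 ≤ A i j)
    (h : ∀ I J : Finset ι, I.Nonempty → (∀ i ∈ I, ∀ j ∈ I, A i j = 0) →
      (∀ j, j ∉ I → (∃ i ∈ I, A i j ≠ 0) → j ∈ J) → I.card < J.card) :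
    volume {t : ι → ℝ | (∀ i, 0 ≤ t i) ∧ ∑ i, ∑ j, A i j * t i * t j < 1} < ⊤ := by
  obtain ⟨c, hc0, hc⟩ : ∃ c : ℝ, 0 < c ∧ ∀ i j, A i j ≠ 0 → c ^ 2 ≤ A i j := by
    have : ∀ ij : ι × ι, ∃ c : ℝ, 0 < c ∧ (A ij.1 ij.2 ≠ 0 → c ^ 2 ≤ A ij.1 ij.2) := by
      intro ij
      rcases (hA ij.1 ij.2).eq_or_lt with h0 | h0
      · exact ⟨1, one_pos, fun h => (h h0.symm).elim⟩
      · exact ⟨√(A ij.1 ij.2), Real.sqrt_pos.2 h0, fun _ => (Real.sq_sqrt h0.le).le⟩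
    choose c hc0 hc using this
    obtain ⟨ij, hij⟩ := Finite.exists_min c
    exact ⟨c ij, hc0 ij, fun i j h =>
      (pow_le_pow_left₀ (hc0 ij).le (hij (i, j)) 2).trans (hc (i, j) h)⟩
  set P := {t : ι → ℝ | (∀ i, 0 < t i) ∧ ∀ i j, A i j ≠ 0 → t i * t j ≤ 1} with hP
  have hPtop : volume P < ⊤ := volume_forall_mul_le_one_lt_top _ (by simpa using h)
  have hae : {t : ι → ℝ | (∀ i, 0 ≤ t i) ∧ ∑ i, ∑ j, A i j * t i * t j < 1} ⊆
      c⁻¹ • P ∪ ⋃ i, {t : ι → ℝ | t i = 0} := by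
    rintro t ⟨ht0, ht⟩
    by_cases hz : ∃ i, t i = 0
    · exact Or.inr (Set.mem_iUnion.2 hz)
    push Not at hz
    left
    rw [Set.mem_inv_smul_set_iff₀ hc0.ne']
    have ht1 : ∀ i, 0 < t i := fun i => (ht0 i).lt_of_ne (hz i).symm
    refine ⟨fun i => mul_pos hc0 (ht1 i), fun i j hij => ?_⟩
    have hnn : ∀ i j, 0 ≤ A i j * t i * t j := fun i j =>
      mul_nonneg (mul_nonneg (hA i j) (ht0 i)) (ht0 j)
    calc (c • t) i * (c • t) j = c ^ 2 * t i * t j := by simp only [Pi.smul_apply, smul_eq_mul]; ring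
      _ ≤ A i j * t i * t j := by
          have := hc i j hij
          have := ht0 i
          have := ht0 j
          gcongr
      _ ≤ ∑ j, A i j * t i * t j :=
          Finset.single_le_sum (f := fun j => A i j * t i * t j) (fun j _ => hnn i j)
            (Finset.mem_univ j)
      _ ≤ ∑ i, ∑ j, A i j * t i * t j :=
          Finset.single_le_sum (f := fun i => ∑ j, A i j * t i * t j)
            (fun i _ => Finset.sum_nonneg fun j _ => hnn i j) (Finset.mem_univ i)
      _ ≤ 1 := ht.le
  have hnull : volume (⋃ i, {t : ι → ℝ | t i = 0}) = 0 :=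
    measure_iUnion_null fun i => Measure.pi_hyperplane _ i 0
  refine (measure_mono hae).trans_lt ((measure_union_le _ _).trans_lt ?_)
  rw [hnull, add_zero, Measure.addHaar_smul]
  exact ENNReal.mul_lt_top ENNReal.ofReal_lt_top hPtop

variable {p q : ℕ}

/-- The signs in the diagonal form. -/
def sgn (p q : ℕ) (i : Fin (p + q + 1)) : ℝ := if (i : ℕ) < p then 1 else -1

theorem sgn_mul_self (i : Fin (p + q + 1)) : sgn p q i * sgn p q i = 1 := by
  unfold sgn; split_ifs <;> norm_num

theorem abs_sgn (i : Fin (p + q + 1)) : |sgn p q i| = 1 := by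
  unfold sgn; split_ifs <;> norm_num

theorem form_comm (x y : Space p q) : form p q x y = form p q y x := by
  rw [form_apply, form_apply]
  exact Finset.sum_congr rfl fun i _ => by ring

theorem form_single_left (i : Fin (p + q + 1)) (x : Space p q) :
    form p q (Pi.single i 1) x = sgn p q i * x i := by
  rw [form_apply, Finset.sum_eq_single i (fun j _ hj => by simp [Pi.single_eq_of_ne hj]) (by simp)]
  simp [sgn]

theorem continuous_form_self : Continuous fun x : Space p q => form p q x x := by
  simp only [form_apply]
  fun_prop

theorem affinePoint_self (k : Fin (p + q + 1)) (u : Fin (p + q) → ℝ) : affinePoint k u k = 1 := by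
  simp [affinePoint]

theorem affinePoint_succAbove (k : Fin (p + q + 1)) (u : Fin (p + q) → ℝ) (j : Fin (p + q)) :
    affinePoint k u (k.succAbove j) = u j := by
  simp [affinePoint]

theorem affinePoint_add_smul_single (k : Fin (p + q + 1)) (u : Fin (p + q) → ℝ) (j : Fin (p + q))
    (t : ℝ) : affinePoint k (u + t • Pi.single j 1) =
      affinePoint k u + t • Pi.single (k.succAbove j) 1 := by
  ext i
  rcases Fin.eq_self_or_eq_succAbove k i with rfl | ⟨l, rfl⟩
  · simp [affinePoint_self, Fin.ne_succAbove]
  · simp [affinePoint_succAbove, Pi.single_apply]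

theorem contDiff_affinePoint (k : Fin (p + q + 1)) :
    ContDiff ℝ 1 (affinePoint k : (Fin (p + q) → ℝ) → Space p q) := by
  rw [contDiff_pi]
  intro i
  rcases Fin.eq_self_or_eq_succAbove k i with rfl | ⟨l, rfl⟩
  · simp only [affinePoint_self]; exact contDiff_const
  · simp only [affinePoint_succAbove]; exact contDiff_apply ℝ ℝ l

theorem differentiableAt_quadricLift (k : Fin (p + q + 1)) (u : Fin (p + q) → ℝ)
    (hu : form p q (affinePoint k u) (affinePoint k u) < 0) :
    DifferentiableAt ℝ (quadricLift k : (Fin (p + q) → ℝ) → Space p q) u := by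
  have h0 := ((contDiff_affinePoint (p := p) (q := q) k).differentiable one_ne_zero) u
  have h1 : DifferentiableAt ℝ
      (fun u => form p q (affinePoint k u) (affinePoint k u)) u := by
    have h2 : ∀ i, DifferentiableAt ℝ (fun u => affinePoint (p := p) (q := q) k u i) u :=
      differentiableAt_pi.1 h0
    simp only [form_apply]
    fun_prop
  refine DifferentiableAt.smul (DifferentiableAt.inv (h1.neg.sqrt (by simpa using hu.ne)) ?_) h0
  exact (Real.sqrt_pos.2 (neg_pos.2 hu)).ne'

theorem fderiv_quadricLift_single (k : Fin (p + q + 1)) (u : Fin (p + q) → ℝ)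
    (hu : form p q (affinePoint k u) (affinePoint k u) < 0) (j : Fin (p + q)) :
    fderiv ℝ (quadricLift k) u (Pi.single j 1) =
      (√(-form p q (affinePoint k u) (affinePoint k u)))⁻¹ •
        (Pi.single (k.succAbove j) 1 +
          (sgn p q (k.succAbove j) * u j / (-form p q (affinePoint k u) (affinePoint k u))) •
            affinePoint k u) := by
  rw [← (differentiableAt_quadricLift k u hu).lineDeriv_eq_fderiv]
  refine HasLineDerivAt.lineDeriv ?_
  rw [HasLineDerivAt]
  unfold quadricLift
  simp only [affinePoint_add_smul_single]
  set y := affinePoint k u with hy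
  set w : Space p q := Pi.single (k.succAbove j) 1 with hw
  have hwy : form p q w y = sgn p q (k.succAbove j) * u j := by
    rw [hw, form_single_left, hy, affinePoint_succAbove]
  set Q := -form p q y y with hQ
  have hQ0 : 0 < Q := neg_pos.2 hu
  rw [← hwy]
  have h1 : HasDerivAt (fun t : ℝ => -form p q (y + t • w) (y + t • w))
      (-(2 * form p q w y)) 0 := by
    have h2 : (fun t : ℝ => -form p q (y + t • w) (y + t • w)) =
        fun t => Q - (t * (2 * form p q w y) + t ^ 2 * form p q w w) := by
      funext t
      simp only [map_add, map_smul, LinearMap.add_apply, LinearMap.smul_apply, smul_eq_mul,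
        form_comm y w, hQ]
      ring
    rw [h2]
    have h3 : HasDerivAt
        (fun t : ℝ => Q - (t * (2 * form p q w y) + t ^ 2 * form p q w w)) _ 0 :=
      (((hasDerivAt_id (0 : ℝ)).mul_const (2 * form p q w y)).add
      (((hasDerivAt_id (0 : ℝ)).pow 2).mul_const (form p q w w))).const_sub Q
    exact h3.congr_deriv (by simp)
  have h0 : -form p q (y + (0 : ℝ) • w) (y + (0 : ℝ) • w) = Q := by simp [hQ]
  have h2 := h1.sqrt (by rw [h0]; exact hQ0.ne')
  have hs : 0 < √Q := Real.sqrt_pos.2 hQ0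
  have h3 := h2.inv (by rw [h0]; exact hs.ne')
  have h4 : HasDerivAt (fun t : ℝ => y + t • w) w 0 := by
    simpa using ((hasDerivAt_id (0 : ℝ)).smul_const w).const_add y
  have h5 : HasDerivAt (fun t : ℝ => (√(-form p q (y + t • w) (y + t • w)))⁻¹ • (y + t • w)) _ 0 :=
    h3.smul h4
  refine h5.congr_deriv ?_
  have hsq : √Q ^ 2 = Q := Real.sq_sqrt hQ0.le
  simp only [Pi.inv_apply, zero_smul, add_zero, ← hQ, hsq, smul_add, smul_smul]
  congr 2
  field_simp

theorem metric_eq (k : Fin (p + q + 1)) (u : Fin (p + q) → ℝ)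
    (hu : form p q (affinePoint k u) (affinePoint k u) < 0) :
    metric k u = (-form p q (affinePoint k u) (affinePoint k u))⁻¹ •
      (Matrix.diagonal (fun i => sgn p q (k.succAbove i)) *
        (1 + Matrix.replicateCol Unit
            (fun i => u i / (-form p q (affinePoint k u) (affinePoint k u))) *
          Matrix.replicateRow Unit (fun j => sgn p q (k.succAbove j) * u j))) := by
  ext i j
  rw [Matrix.smul_apply, Matrix.diagonal_mul, Matrix.add_apply, Matrix.mul_apply]
  simp only [metric, Matrix.of_apply, fderiv_quadricLift_single k u hu, Matrix.replicateCol_apply,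
    Matrix.replicateRow_apply, Finset.univ_unique, Finset.sum_singleton, map_add, map_smul,
    LinearMap.add_apply, LinearMap.smul_apply, smul_eq_mul, form_single_left,
    form_comm (affinePoint k u) (Pi.single _ 1), affinePoint_succAbove, Matrix.one_apply,
    Pi.single_apply, (Fin.succAbove_right_injective (p := k)).eq_iff]
  set Q := -form p q (affinePoint k u) (affinePoint k u) with hQ
  have hQ' : form p q (affinePoint k u) (affinePoint k u) = -Q := by rw [hQ, neg_neg]
  have hQ0 : 0 < Q := neg_pos.2 hu
  have hs : 0 < √Q := Real.sqrt_pos.2 hQ0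
  have hsq : √Q * √Q = Q := Real.mul_self_sqrt hQ0.le
  have hsq' : (√Q)⁻¹ * (√Q)⁻¹ = Q⁻¹ := by rw [← mul_inv, hsq]
  rw [hQ', ← hsq']
  field_simp
  ring

/-- The density of the volume in an affine chart is the square root of `(-b(x, x))⁻¹ ^ (p + q + 1)`. -/
theorem abs_det_metric (k : Fin (p + q + 1)) (u : Fin (p + q) → ℝ)
    (hu : form p q (affinePoint k u) (affinePoint k u) < 0) :
    |(metric k u).det| = (-form p q (affinePoint k u) (affinePoint k u))⁻¹ ^ (p + q + 1) := by
  rw [metric_eq k u hu, Matrix.det_smul, Matrix.det_mul, Matrix.det_diagonal,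
    Matrix.det_one_add_replicateCol_mul_replicateRow]
  set Q := -form p q (affinePoint k u) (affinePoint k u) with hQ
  have hQ0 : 0 < Q := neg_pos.2 hu
  have h1 : Q = -(sgn p q k + ∑ j, sgn p q (k.succAbove j) * u j * u j) := by
    rw [hQ, form_apply, Fin.sum_univ_succAbove _ k]
    simp only [affinePoint_self, affinePoint_succAbove, mul_one]
    rfl
  have h2 : 1 + (fun j => sgn p q (k.succAbove j) * u j) ⬝ᵥ (fun i => u i / Q) =
      -sgn p q k * Q⁻¹ := by
    have h3 : (fun j => sgn p q (k.succAbove j) * u j) ⬝ᵥ (fun i => u i / Q) =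
        (∑ j, sgn p q (k.succAbove j) * u j * u j) / Q := by
      rw [dotProduct, Finset.sum_div]
      exact Finset.sum_congr rfl fun j _ => by ring
    have h4 : ∑ j, sgn p q (k.succAbove j) * u j * u j = -Q - sgn p q k := by linarith
    rw [h3, h4]
    field_simp
    ring
  rw [h2, Fintype.card_fin, abs_mul, abs_mul, abs_mul, abs_neg, abs_sgn, Finset.abs_prod,
    abs_of_pos (pow_pos (inv_pos.2 hQ0) _), abs_of_pos (inv_pos.2 hQ0), pow_succ]
  simp [abs_sgn]

theorem mk_mem_hyp {x : Space p q} (hx : x ≠ 0) :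
    Projectivization.mk ℝ x hx ∈ hyp p q ↔ form p q x x < 0 := by
  rw [hyp, Set.mem_ofPred_eq, Projectivization.submodule_mk]
  refine ⟨fun h => h x (Submodule.mem_span_singleton_self x) hx, fun h v hv hv0 => ?_⟩
  obtain ⟨a, rfl⟩ := Submodule.mem_span_singleton.1 hv
  have ha : a ≠ 0 := by rintro rfl; simp at hv0
  have := mul_pos_of_neg_of_neg h (neg_neg_of_pos (sq_pos_of_ne_zero ha))
  simp only [map_smul, LinearMap.smul_apply, smul_eq_mul]
  nlinarith

/-- All but the first affine chart contribute null sets to the volume. -/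
theorem vol_eq_setLIntegral (A : Set (Proj p q)) :
    vol A = ∫⁻ u in {u : Fin (p + q) → ℝ | affineChart (0 : Fin (p + q + 1)) u ∈ A ∩ hyp p q},
      ENNReal.ofReal √|(metric (0 : Fin (p + q + 1)) u).det| := by
  rw [vol, Finset.sum_eq_single 0 ?_ (by simp)]
  · simp
  · intro k _ hk
    obtain ⟨j, hj⟩ := Fin.exists_succAbove_eq hk.symm
    refine setLIntegral_measure_zero _ _ (measure_mono_null ?_ (Measure.pi_hyperplane _ j 0))
    rintro u ⟨-, hu⟩
    have h := hu 0 (Fin.pos_iff_ne_zero.2 hk)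
    rwa [← hj, affinePoint_succAbove] at h

/-- The part of the cone over `A ∩ H^{p,q}` inside the quadric `b(x, x) = -1`. -/
def cone (A : Set (Proj p q)) : Set (Space p q) :=
  {x | ∃ h : x ≠ 0, Projectivization.mk ℝ x h ∈ A} ∩ {x | form p q x x < 0} ∩
    {x | -1 < form p q x x}

theorem isOpen_setOf_mk_mem {A : Set (Proj p q)} (hA : IsOpen A) :
    IsOpen {x : Space p q | ∃ h : x ≠ 0, Projectivization.mk ℝ x h ∈ A} := by
  have h1 := isOpen_coinduced.1 hA
  have h2 := (isOpen_ne (x := (0 : Space p q))).isOpenMap_subtype_val _ h1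
  convert h2 using 1
  ext x
  simp [Set.mem_image]

theorem isOpen_cone {A : Set (Proj p q)} (hA : IsOpen A) : IsOpen (cone A) :=
  ((isOpen_setOf_mk_mem hA).inter (isOpen_lt continuous_form_self continuous_const)).inter
    (isOpen_lt continuous_const continuous_form_self)

theorem mk_smul {x : Space p q} (hx : x ≠ 0) {a : ℝ} (h : a • x ≠ 0) :
    Projectivization.mk ℝ (a • x) h = Projectivization.mk ℝ x hx := by
  rw [Projectivization.mk_eq_mk_iff']
  exact ⟨a, rfl⟩

theorem smul_affinePoint_mem_cone (A : Set (Proj p q)) (k : Fin (p + q + 1))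
    (u : Fin (p + q) → ℝ) {r : ℝ} (hr : r ≠ 0) :
    r • affinePoint k u ∈ cone A ↔ affineChart k u ∈ A ∩ hyp p q ∧
      r ^ 2 * (-form p q (affinePoint k u) (affinePoint k u)) < 1 := by
  have h0 := affinePoint_ne_zero k u
  have hne : r • affinePoint k u ≠ 0 := smul_ne_zero hr h0
  have h1 : (∃ h : r • affinePoint k u ≠ 0, Projectivization.mk ℝ (r • affinePoint k u) h ∈ A) ↔
      affineChart k u ∈ A := by
    rw [exists_prop_of_true hne, mk_smul h0]; rfl
  have h2 : form p q (r • affinePoint k u) (r • affinePoint k u) =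
      r ^ 2 * form p q (affinePoint k u) (affinePoint k u) := by
    simp only [map_smul, LinearMap.smul_apply, smul_eq_mul]; ring
  have h3 : affineChart k u ∈ hyp p q ↔ form p q (affinePoint k u) (affinePoint k u) < 0 :=
    mk_mem_hyp h0
  simp only [cone, Set.mem_inter_iff, Set.mem_ofPred_eq, h1, h2, h3, and_assoc]
  have h4 : 0 < r ^ 2 := by positivity
  have h5 : ∀ z : ℝ, r ^ 2 * z < 0 ↔ z < 0 := fun z =>
    ⟨fun h => by by_contra! hz; nlinarith [mul_nonneg h4.le hz], mul_neg_of_pos_of_neg h4⟩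
  rw [h5, mul_neg, neg_lt]

theorem lintegral_pow_of_sq_mul_lt_one (m : ℕ) {Q : ℝ} (hQ : 0 < Q) :
    ∫⁻ r in {r : ℝ | 0 < r ∧ r ^ 2 * Q < 1}, ENNReal.ofReal (r ^ m) =
      ENNReal.ofReal (1 / (m + 1)) * ENNReal.ofReal √(Q⁻¹ ^ (m + 1)) := by
  have hs : 0 < √Q := Real.sqrt_pos.2 hQ
  have h1 : {r : ℝ | 0 < r ∧ r ^ 2 * Q < 1} = Set.Ioo 0 (√Q)⁻¹ := by
    ext r
    simp only [Set.mem_ofPred_eq, Set.mem_Ioo]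
    refine and_congr_right fun hr => ?_
    rw [← one_div, lt_div_iff₀ hs, ← Real.sq_sqrt hQ.le, ← mul_pow, Real.sqrt_sq hs.le]
    exact pow_lt_one_iff_of_nonneg (by positivity) two_ne_zero
  rw [h1, restrict_Ioo_eq_restrict_Ioc, ← ofReal_integral_eq_lintegral_ofReal,
    ← intervalIntegral.integral_of_le (by positivity), integral_pow,
    ← ENNReal.ofReal_mul (by positivity)]
  · congr 1
    have h2 : √(Q⁻¹ ^ (m + 1)) = (√Q)⁻¹ ^ (m + 1) := by
      rw [← Real.sqrt_inv, Real.sqrt_eq_iff_mul_self_eq (by positivity) (by positivity),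
        ← mul_pow, Real.mul_self_sqrt (by positivity)]
    rw [h2, zero_pow (Nat.succ_ne_zero m)]
    ring
  · exact ((continuous_pow m).integrableOn_Icc).mono_set Set.Ioc_subset_Icc_self
  · filter_upwards [ae_restrict_mem measurableSet_Ioc] with r hr
    exact pow_nonneg hr.1.le m

theorem continuous_affinePoint (k : Fin (p + q + 1)) :
    Continuous (affinePoint k : (Fin (p + q) → ℝ) → Space p q) :=
  (contDiff_affinePoint k).continuous

theorem isOpen_preimage_affineChart {A : Set (Proj p q)} (hA : IsOpen A) (k : Fin (p + q + 1)) :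
    IsOpen {u : Fin (p + q) → ℝ | affineChart k u ∈ A ∩ hyp p q} := by
  have h1 := ((isOpen_setOf_mk_mem hA).inter
    (isOpen_lt continuous_form_self (continuous_const (y := (0 : ℝ))))).preimage (continuous_affinePoint k)
  convert h1 using 1
  ext u
  simp only [Set.mem_ofPred_eq, Set.mem_inter_iff, Set.mem_preimage]
  rw [exists_prop_of_true (affinePoint_ne_zero k u), ← mk_mem_hyp (affinePoint_ne_zero k u)]
  rfl

/-- The volume of an open subset of `H^{p,q}` is, up to a constant, the Lebesgue measure of the half of
the truncated cone over it on which the first coordinate is positive. -/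
theorem volume_cone_inter_pos {A : Set (Proj p q)} (hA : IsOpen A) :
    volume (cone A ∩ {x | 0 < x 0}) = ENNReal.ofReal (1 / ((p + q : ℕ) + 1)) * vol A := by
  set D := {u : Fin (p + q) → ℝ | affineChart (0 : Fin (p + q + 1)) u ∈ A ∩ hyp p q} with hD
  have hDm : MeasurableSet D := (isOpen_preimage_affineChart hA 0).measurableSet
  let Q : (Fin (p + q) → ℝ) → ℝ := fun u =>
    -form p q (affinePoint 0 u) (affinePoint 0 u)
  have hQm : Continuous Q := (continuous_form_self.comp (continuous_affinePoint 0)).neg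
  have hDQ : ∀ u ∈ D, 0 < Q u := fun u hu => neg_pos.2 ((mk_mem_hyp _).1 hu.2)
  let e := (MeasurableEquiv.piFinSuccAbove (fun _ : Fin (p + q + 1) => ℝ) 0).symm
  have he : MeasurePreserving e volume volume :=
    (volume_preserving_piFinSuccAbove (fun _ : Fin (p + q + 1) => ℝ) 0).symm _
  have hSm : MeasurableSet (cone A ∩ {x : Space p q | 0 < x 0}) :=
    ((isOpen_cone hA).inter (isOpen_lt continuous_const (continuous_apply 0))).measurableSet
  have hslice : ∀ r : ℝ, volume (Prod.mk r ⁻¹' (e ⁻¹' (cone A ∩ {x : Space p q | 0 < x 0}))) =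
      ∫⁻ u in D, {r : ℝ | 0 < r ∧ r ^ 2 * Q u < 1}.indicator
        (fun r => ENNReal.ofReal (r ^ (p + q))) r := by
    intro r
    have he0 : ∀ w, e (r, w) 0 = r := fun w => by simp [e]
    by_cases hr : 0 < r
    · have h1 : Prod.mk r ⁻¹' (e ⁻¹' (cone A ∩ {x : Space p q | 0 < x 0})) =
          r • (D ∩ {u | r ^ 2 * Q u < 1}) := by
        ext w
        rw [Set.mem_smul_set_iff_inv_smul_mem₀ hr.ne']
        have h2 : e (r, w) = r • affinePoint 0 (r⁻¹ • w) := by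
          ext i
          rcases Fin.eq_self_or_eq_succAbove 0 i with rfl | ⟨l, rfl⟩
          · rw [he0, Pi.smul_apply, affinePoint_self, smul_eq_mul, mul_one]
          · rw [Pi.smul_apply, affinePoint_succAbove, Pi.smul_apply, smul_inv_smul₀ hr.ne']
            simp [e]
        simp only [Set.mem_preimage, Set.mem_inter_iff, Set.mem_ofPred_eq, he0, hr, and_true]
        rw [h2, smul_affinePoint_mem_cone A 0 _ hr.ne']
        rfl
      rw [h1, Measure.addHaar_smul, Module.finrank_fin_fun, abs_of_pos (pow_pos hr _)]
      have h3 : ∀ u, {r : ℝ | 0 < r ∧ r ^ 2 * Q u < 1}.indicator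
          (fun r => ENNReal.ofReal (r ^ (p + q))) r =
          {u | r ^ 2 * Q u < 1}.indicator (fun _ => ENNReal.ofReal (r ^ (p + q))) u := by
        intro u
        simp only [Set.indicator_apply, Set.mem_ofPred_eq, hr, true_and]
      simp only [h3]
      have h4 : MeasurableSet {u | r ^ 2 * Q u < 1} :=
        (isOpen_lt (continuous_const.mul hQm) continuous_const).measurableSet
      rw [lintegral_indicator_const h4, Measure.restrict_apply h4, Set.inter_comm]
    · have h1 : Prod.mk r ⁻¹' (e ⁻¹' (cone A ∩ {x : Space p q | 0 < x 0})) = ∅ := by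
        ext w
        simp [he0, hr]
      rw [h1, measure_empty]
      simp [hr]
  rw [← he.measure_preimage hSm.nullMeasurableSet, Measure.volume_eq_prod,
    Measure.prod_apply (e.measurable hSm)]
  simp only [hslice]
  rw [lintegral_lintegral_swap]
  · rw [vol_eq_setLIntegral, ← lintegral_const_mul' _ _ ENNReal.ofReal_ne_top]
    refine setLIntegral_congr_fun hDm fun u hu => ?_
    have h5 : MeasurableSet {r : ℝ | 0 < r ∧ r ^ 2 * Q u < 1} :=
      (IsOpen.and (isOpen_lt continuous_const continuous_id)
        (isOpen_lt ((continuous_pow 2).mul continuous_const) continuous_const)).measurableSet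
    rw [lintegral_indicator h5, lintegral_pow_of_sq_mul_lt_one _ (hDQ u hu),
      abs_det_metric 0 u ((mk_mem_hyp _).1 hu.2)]
  · refine Measurable.aemeasurable ?_
    have h6 : MeasurableSet {z : ℝ × (Fin (p + q) → ℝ) | 0 < z.1 ∧ z.1 ^ 2 * Q z.2 < 1} :=
      (IsOpen.and (isOpen_lt continuous_const continuous_fst)
        (isOpen_lt ((continuous_fst.pow 2).mul (hQm.comp continuous_snd))
          continuous_const)).measurableSet
    exact Measurable.indicator (f := fun z : ℝ × (Fin (p + q) → ℝ) =>
      ENNReal.ofReal (z.1 ^ (p + q))) (by fun_prop) h6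

theorem neg_mem_cone {A : Set (Proj p q)} {x : Space p q} (hx : x ∈ cone A) : -x ∈ cone A := by
  obtain ⟨⟨⟨h0, hA⟩, h1⟩, h2⟩ := hx
  refine ⟨⟨⟨neg_ne_zero.2 h0, ?_⟩, ?_⟩, ?_⟩
  · convert hA using 1
    rw [Projectivization.mk_eq_mk_iff']
    exact ⟨-1, by simp⟩
  · simpa using h1
  · simpa using h2

theorem vol_eq_top_iff {A : Set (Proj p q)} (hA : IsOpen A) :
    vol A = ⊤ ↔ volume (cone A) = ⊤ := by
  have h1 := volume_cone_inter_pos hA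
  set S := cone A ∩ {x : Space p q | 0 < x 0} with hS
  have hc : ENNReal.ofReal (1 / ((p + q : ℕ) + 1)) ≠ 0 := by
    rw [ne_eq, ENNReal.ofReal_eq_zero, not_le]; positivity
  have h2 : vol A = ⊤ ↔ volume S = ⊤ := by
    rw [h1, ENNReal.mul_eq_top]
    simp only [ENNReal.ofReal_ne_top, false_and, or_false, ne_eq, hc, not_false_eq_true, true_and]
  rw [h2]
  refine ⟨fun h => measure_mono_top Set.inter_subset_left h, fun h => ?_⟩
  by_contra hS'
  have hsub : cone A ⊆ (S ∪ -S) ∪ {x : Space p q | x 0 = 0} := by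
    intro x hx
    rcases lt_trichotomy (x 0) 0 with h0 | h0 | h0
    · exact Or.inl (Or.inr ⟨neg_mem_cone hx, by simpa using h0⟩)
    · exact Or.inr h0
    · exact Or.inl (Or.inl ⟨hx, h0⟩)
  have h3 := (measure_mono (μ := volume) hsub).trans
    ((measure_union_le _ _).trans (add_le_add_left (measure_union_le _ _) _))
  have h4 : volume {x : Space p q | x 0 = 0} = 0 := Measure.pi_hyperplane _ 0 0
  rw [h, h4, Measure.measure_neg, add_zero, top_le_iff, ENNReal.add_eq_top, or_self] at h3
  exact hS' h3

theorem IsLift.submodule_eq {Λ : Set (Proj p q)} {s : Λ → Space p q} (hs : IsLift s) (ξ : Λ) :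
    ξ.1.submodule = Submodule.span ℝ {s ξ} := by
  obtain ⟨h0, h1⟩ := hs ξ
  rw [Projectivization.submodule_eq] at h1 ⊢
  obtain ⟨a, ha⟩ := Submodule.mem_span_singleton.1 h1
  have ha0 : a ≠ 0 := by rintro rfl; exact h0 (by rw [← ha, zero_smul])
  rw [← ha, Submodule.span_singleton_smul_eq (IsUnit.mk0 a ha0)]

theorem IsLift.orthogonal_iff {Λ : Set (Proj p q)} {s : Λ → Space p q} (hs : IsLift s) (ξ η : Λ) :
    Orthogonal ξ.1 η.1 ↔ form p q (s ξ) (s η) = 0 := by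
  refine ⟨fun h => h _ (hs ξ).2 _ (hs η).2, fun h v hv w hw => ?_⟩
  rw [hs.submodule_eq] at hv hw
  obtain ⟨a, rfl⟩ := Submodule.mem_span_singleton.1 hv
  obtain ⟨c, rfl⟩ := Submodule.mem_span_singleton.1 hw
  simp [h]

theorem IsSimplex.exists_basis {Λ : Set (Proj p q)} [Fintype Λ] (hΛ : IsSimplex Λ)
    {s : Λ → Space p q} (hs : IsLift s) : ∃ b : Module.Basis Λ ℝ (Space p q), ⇑b = s := by
  have hspan : ⊤ ≤ Submodule.span ℝ (Set.range s) := by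
    rw [← hΛ.span_eq_top]
    refine iSup₂_le fun ξ hξ => ?_
    rw [hs.submodule_eq ⟨ξ, hξ⟩]
    exact Submodule.span_mono (Set.singleton_subset_iff.2 (Set.mem_range_self _))
  have hcard : Fintype.card Λ = Module.finrank ℝ (Space p q) := by
    rw [Module.finrank_fin_fun, ← hΛ.ncard_eq, ← Nat.card_coe_set_eq, Nat.card_eq_fintype_card]
  exact ⟨basisOfTopLeSpanOfCardEqFinrank s hspan hcard,
    coe_basisOfTopLeSpanOfCardEqFinrank s hspan hcard⟩

theorem form_ne_zero : form p q ≠ 0 := by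
  intro h
  have h1 := form_single_left (p := p) (q := q) 0 (Pi.single 0 1)
  rw [h, LinearMap.zero_apply, LinearMap.zero_apply, Pi.single_eq_same, mul_one] at h1
  simpa [← h1] using sgn_mul_self (p := p) (q := q) 0

section Coordinates

variable {Λ : Set (Proj p q)} [Fintype Λ] (b : Module.Basis Λ ℝ (Space p q))

theorem form_equivFun_symm (t : Λ → ℝ) :
    form p q (b.equivFun.symm t) (b.equivFun.symm t) =
      -∑ i, ∑ j, -form p q (b i) (b j) * t i * t j := by
  simp only [Module.Basis.equivFun_symm_apply, map_sum, map_smul, LinearMap.sum_apply,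
    LinearMap.smul_apply, smul_eq_mul, neg_mul, Finset.sum_neg_distrib, neg_neg]
  refine Finset.sum_congr rfl fun i _ => ?_
  rw [Finset.mul_sum]
  refine Finset.sum_congr rfl fun j _ => ?_
  rw [form_comm]
  ring

theorem convexHull_subset_repr_nonneg :
    convexHull ℝ (Set.range b) ⊆ {x | ∀ i, 0 ≤ b.equivFun x i} := by
  classical
  refine convexHull_min ?_ ?_
  · rintro _ ⟨j, rfl⟩ i
    rw [Module.Basis.equivFun_self]
    split_ifs <;> simp
  · intro x hx y hy a c ha hc _ i
    rw [map_add, map_smul, map_smul]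
    exact add_nonneg (mul_nonneg ha (hx i)) (mul_nonneg hc (hy i))

theorem mem_hull_of_repr_pos [Nonempty Λ] {x : Space p q} (hx0 : x ≠ 0)
    (hx : ∀ i, 0 < b.equivFun x i) : Projectivization.mk ℝ x hx0 ∈ hull b := by
  have hcont : Continuous b.equivFun := 
    LinearMap.continuous_of_finiteDimensional b.equivFun.toLinearMap
  have hopen : IsOpen {y : Space p q | ∀ i, 0 < b.equivFun y i} := by
    simp only [Set.ofPred_forall]
    exact isOpen_iInter_of_finite fun i =>
      isOpen_lt continuous_const ((continuous_apply i).comp hcont)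
  refine mem_interior.2 ⟨{ξ | ∃ v ∈ ξ.submodule, ∀ i, 0 < b.equivFun v i}, ?_, ?_, ?_⟩
  · rintro ξ ⟨v, hvξ, hv⟩
    have hT : 0 < ∑ i, b.equivFun v i := Finset.sum_pos (fun i _ => hv i) Finset.univ_nonempty
    have hv0 : v ≠ 0 := by
      rintro rfl
      simpa using hv (Classical.arbitrary Λ)
    refine ⟨(∑ i, b.equivFun v i)⁻¹ • v, ?_, smul_ne_zero (inv_ne_zero hT.ne') hv0,
      ξ.submodule.smul_mem _ hvξ⟩
    have h := Finset.univ.centerMass_mem_convexHull (s := Set.range b) (R := ℝ)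
      (w := b.equivFun v) (z := b) (fun i _ => (hv i).le) hT fun i _ => Set.mem_range_self i
    rwa [Finset.centerMass, b.sum_equivFun] at h
  · rw [isOpen_coinduced]
    have h1 : IsOpen ((⋃ a : ℝ, {y : Space p q | ∀ i, 0 < b.equivFun (a • y) i})) :=
      isOpen_iUnion fun a => hopen.preimage (continuous_const_smul a)
    convert h1.preimage continuous_subtype_val using 1
    ext ⟨y, hy⟩
    simp only [Set.mem_preimage, Set.mem_ofPred_eq, Projectivization.submodule_mk, Set.mem_iUnion,
      Submodule.mem_span_singleton]
    constructor
    · rintro ⟨_, ⟨a, rfl⟩, h⟩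
      exact ⟨a, h⟩
    · rintro ⟨a, h⟩
      exact ⟨_, ⟨a, rfl⟩, h⟩
  · refine ⟨x, ?_, hx⟩
    rw [Projectivization.submodule_mk]
    exact Submodule.mem_span_singleton_self x

theorem repr_nonneg_or_of_mem_hull {x : Space p q} (hx0 : x ≠ 0)
    (hx : Projectivization.mk ℝ x hx0 ∈ hull b) :
    (∀ i, 0 ≤ b.equivFun x i) ∨ ∀ i, 0 ≤ b.equivFun (-x) i := by
  obtain ⟨v, hv, hv0, hvx⟩ := interior_subset hx
  rw [Projectivization.submodule_mk] at hvx
  obtain ⟨a, rfl⟩ := Submodule.mem_span_singleton.1 hvx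
  have h := convexHull_subset_repr_nonneg b hv
  simp only [Set.mem_ofPred_eq, map_smul, Pi.smul_apply, smul_eq_mul] at h
  rcases lt_trichotomy a 0 with ha | rfl | ha
  · right
    intro i
    rw [map_neg, Pi.neg_apply]
    nlinarith [h i]
  · simp at hv0
  · exact Or.inl fun i => nonneg_of_mul_nonneg_right (h i) ha

theorem volume_preimage_equivFun_symm_eq_top_iff (X : Set (Space p q)) :
    volume (b.equivFun.symm ⁻¹' X) = ⊤ ↔ volume X = ⊤ := by
  let L : (Λ → ℝ) ≃L[ℝ] Space p q := b.equivFun.symm.toContinuousLinearEquiv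
  have : (Measure.map L (volume : Measure (Λ → ℝ))).IsAddHaarMeasure := L.isAddHaarMeasure_map _
  have h2 := Measure.isAddLeftInvariant_eq_smul (Measure.map L (volume : Measure (Λ → ℝ))) volume
  have hc := Measure.addHaarScalarFactor_pos_of_isAddHaarMeasure
    (Measure.map L (volume : Measure (Λ → ℝ))) volume
  have h3 : volume (b.equivFun.symm ⁻¹' X) = Measure.map L volume X :=
    (L.toHomeomorph.toMeasurableEquiv.map_apply X).symm
  rw [h3, h2, Measure.smul_apply, ENNReal.smul_def, smul_eq_mul, ENNReal.mul_eq_top]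
  simp [hc.ne']

theorem setOf_pos_subset_preimage_cone_hull [Nonempty Λ]
    (hb : ∀ i j, form p q (b i) (b j) ≤ 0) :
    {t : Λ → ℝ | (∀ i, 0 < t i) ∧ ∑ i, ∑ j, -form p q (b i) (b j) * t i * t j < 1} ⊆
      b.equivFun.symm ⁻¹' cone (hull b) := by
  rintro t ⟨ht0, ht⟩
  have hx0 : b.equivFun.symm t ≠ 0 := by
    rw [ne_eq, LinearEquiv.map_eq_zero_iff]
    rintro rfl
    simpa using ht0 (Classical.arbitrary Λ)
  have hnn : ∀ i j, 0 ≤ -form p q (b i) (b j) * t i * t j := fun i j =>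
    mul_nonneg (mul_nonneg (neg_nonneg.2 (hb i j)) (ht0 i).le) (ht0 j).le
  refine ⟨⟨⟨hx0, mem_hull_of_repr_pos b hx0 (by rwa [b.equivFun.apply_symm_apply])⟩, ?_⟩, ?_⟩
  · obtain ⟨i, j, hij⟩ : ∃ i j, form p q (b i) (b j) ≠ 0 := by
      by_contra! h
      exact form_ne_zero (b.ext fun i => b.ext fun j => h i j)
    rw [Set.mem_ofPred_eq, form_equivFun_symm, neg_lt_zero]
    refine Finset.sum_pos' (fun i _ => Finset.sum_nonneg fun j _ => hnn i j) ⟨i, Finset.mem_univ i,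
      Finset.sum_pos' (fun j _ => hnn i j) ⟨j, Finset.mem_univ j, ?_⟩⟩
    exact mul_pos (mul_pos (neg_pos.2 ((hb i j).lt_of_ne hij)) (ht0 i)) (ht0 j)
  · rw [Set.mem_ofPred_eq, form_equivFun_symm]
    linarith

theorem preimage_cone_hull_subset :
    b.equivFun.symm ⁻¹' cone (hull b) ⊆
      {t : Λ → ℝ | (∀ i, 0 ≤ t i) ∧ ∑ i, ∑ j, -form p q (b i) (b j) * t i * t j < 1} ∪
      -{t : Λ → ℝ | (∀ i, 0 ≤ t i) ∧ ∑ i, ∑ j, -form p q (b i) (b j) * t i * t j < 1} := by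
  rintro t ⟨⟨⟨hx0, hx⟩, -⟩, h1⟩
  rw [Set.mem_ofPred_eq, form_equivFun_symm, neg_lt_neg_iff] at h1
  rcases repr_nonneg_or_of_mem_hull b hx0 hx with h | h
  · exact Or.inl ⟨by rwa [b.equivFun.apply_symm_apply] at h, h1⟩
  · refine Or.inr ⟨by rwa [map_neg, b.equivFun.apply_symm_apply] at h, ?_⟩
    simpa using h1

end Coordinates

theorem nonOrthGraph_adj {Λ : Set (Proj p q)} {ξ η : Proj p q} :
    (nonOrthGraph Λ).Adj ξ η ↔ ξ ∈ Λ ∧ η ∈ Λ ∧ ¬ Orthogonal ξ η :=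
  ⟨fun ⟨_, h⟩ => h.2, fun h => ⟨s(ξ, η), rfl, h⟩⟩

theorem encard_eq_card_filter {α : Type*} {Λ S : Set α} [Fintype Λ] [DecidablePred (· ∈ S)]
    (hS : S ⊆ Λ) : S.encard = (Finset.univ.filter fun x : Λ => x.1 ∈ S).card := by
  rw [← Set.encard_coe_eq_coe_finsetCard, ← Subtype.val_injective.encard_image]
  congr 1
  ext x
  simpa using fun h => hS h

end PseudoHyperbolic

end

open PseudoHyperbolic

theorem mainTheorem1 (p q : ℕ) (Λ : Set (PseudoHyperbolic.Proj p q))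
    (hΛ : PseudoHyperbolic.IsSimplex Λ)
    (s : Λ → PseudoHyperbolic.Space p q) (hs : PseudoHyperbolic.IsPositiveLift s) :
    PseudoHyperbolic.vol (PseudoHyperbolic.hull s) = ⊤ ↔
      ∃ I : Set (PseudoHyperbolic.Proj p q), I.Nonempty ∧
        PseudoHyperbolic.IsStable (PseudoHyperbolic.nonOrthGraph Λ) I ∧
        (PseudoHyperbolic.boundary (PseudoHyperbolic.nonOrthGraph Λ) I).encard ≤ I.encard := by
  classical
  have : Fintype Λ := hΛ.isPolytope.1.fintype
  have : Nonempty Λ := by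
    refine (Set.nonempty_of_ncard_ne_zero ?_).to_subtype
    rw [hΛ.ncard_eq]; omega
  obtain ⟨b, hbs⟩ := hΛ.exists_basis hs.isLift
  have hb : ∀ i j, form p q (b i) (b j) ≤ 0 := by rw [hbs]; exact hs.form_nonpos
  have hadj : ∀ i j : Λ, (nonOrthGraph Λ).Adj i.1 j.1 ↔ form p q (b i) (b j) ≠ 0 := fun i j => by
    rw [nonOrthGraph_adj, hs.isLift.orthogonal_iff, hbs]
    exact ⟨fun h => h.2.2, fun h => ⟨i.2, j.2, h⟩⟩
  rw [← hbs, vol_eq_top_iff (A := hull b) isOpen_interior, ← volume_preimage_equivFun_symm_eq_top_iff b]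
  have hA : ∀ i j, 0 ≤ -form p q (b i) (b j) := fun i j => neg_nonneg.2 (hb i j)
  constructor
  · intro htop
    by_contra hno
    have hfin := volume_quadratic_sublevel_lt_top (fun i j => -form p q (b i) (b j)) hA ?_
    · have h1 := (measure_mono (μ := volume) (preimage_cone_hull_subset b)).trans
        (measure_union_le _ _)
      rw [htop, Measure.measure_neg, top_le_iff, ENNReal.add_eq_top, or_self] at h1
      exact hfin.ne h1
    · intro I J hne hI hJ
      by_contra! hcard
      refine hno ⟨Subtype.val '' (I : Set Λ), hne.to_set.image _, ⟨?_, ?_⟩, ?_⟩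
      · rintro _ ⟨i, -, rfl⟩
        exact i.2
      · rintro _ ⟨i, hi, rfl⟩ _ ⟨j, hj, rfl⟩
        rw [hadj, not_not, ← neg_eq_zero]
        exact hI i hi j hj
      · have hsub : boundary (nonOrthGraph Λ) (Subtype.val '' (I : Set Λ)) ⊆
            Subtype.val '' (J : Set Λ) := by
          rintro y ⟨hy, _, ⟨i, hi, rfl⟩, hiy⟩
          have hyΛ := (nonOrthGraph_adj.1 hiy).2.1
          refine ⟨⟨y, hyΛ⟩, hJ _ (fun h => hy ⟨_, h, rfl⟩) ⟨i, hi, ?_⟩, rfl⟩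
          exact neg_ne_zero.2 ((hadj i ⟨y, hyΛ⟩).1 hiy)
        refine (Set.encard_le_encard hsub).trans ?_
        rw [Subtype.val_injective.encard_image, Subtype.val_injective.encard_image,
          Set.encard_coe_eq_coe_finsetCard, Set.encard_coe_eq_coe_finsetCard]
        exact_mod_cast hcard
  · rintro ⟨I, ⟨x, hx⟩, ⟨hIΛ, hstable⟩, hcard⟩
    have hIΛ : I ⊆ Λ := hIΛ
    have hJΛ : boundary (nonOrthGraph Λ) I ⊆ Λ := fun y ⟨_, _, _, h⟩ => (nonOrthGraph_adj.1 h).2.1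
    rw [encard_eq_card_filter hIΛ, encard_eq_card_filter hJΛ] at hcard
    refine measure_mono_top (setOf_pos_subset_preimage_cone_hull b hb)
      (volume_quadratic_sublevel_eq_top (fun i j => -form p q (b i) (b j)) hA
        (fun i j => by rw [form_comm]) _ _ ⟨⟨x, hIΛ hx⟩, Finset.mem_filter.2 ⟨Finset.mem_univ _, hx⟩⟩ ?_ ?_
        (by exact_mod_cast hcard))
    · refine Finset.disjoint_left.2 fun i hi hj => ?_
      exact (Finset.mem_filter.1 hj).2.1 (Finset.mem_filter.1 hi).2
    · intro i hi j hij
      have hi := (Finset.mem_filter.1 hi).2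
      have hij := (hadj i j).2 (neg_ne_zero.1 hij)
      exact Finset.mem_filter.2 ⟨Finset.mem_univ j, fun hj => hstable _ hi _ hj hij, _, hi, hij⟩
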